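/- **Tangle Boundedness Theorem.** A *tangle* is a connected (nonempty) topological space that can be built by taking finitely many disjoint copies of the closed interval $[0,1]$ and identifying some of their endpoints; homeomorphic tangles are considered identical. The six *basic stringable* tangles are: the closed unit interval, the circle, the lollipop (a loop with a segment attached at one of its points), the figure $8$ (two loops sharing one point), the handcuffs (two disjoint loops joined by a segment), and $\Theta$ (three segments with common endpoints). A *monotone continuous valuation* $\nu$ on a tangle $\mathcal{T}$ assigns a real number $\nu(X)\ge 0$ to each connected subset $X\subseteq\mathcal{T}$ (the empty set included) such that 1. (monotone) $\nu(\emptyset)=0$, and $\nu(X)\le\nu(Y)$ whenever $X\subseteq Y$ are connected; 2. (continuous) for every identification of $\mathcal{T}$ with a space obtained from $m$ copies $[0,1]_1,\dots,[0,1]_m$ of $[0,1]$ by gluing endpoints, the value $\nu(X(z))$ is a continuous function of $z$ on $\{z\in\mathbb{R}^{2m} : X(z)\text{ is connected}\}$, where for $z=(x_1,y_1,\dots,x_m,y_m)$ the closed set $X(z)\subseteq\mathcal{T}$ is the union over $i$ of the images in $\mathcal{T}$ of $[x_i,y_i]\cap[0,1]_i$ (with $[x_i,y_i]=\emptyset$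 if $x_i>y_i$). A tangle $\mathcal{T}$ *guarantees envy-free connected allocations for $n$ agents* if for all monotone continuous valuations $\nu_1,\dots,\nu_n$ on $\mathcal{T}$ there is a partition of $\mathcal{T}$ into pairwise disjoint connected (possibly empty) pieces $T_1,\dots,T_n$ such that $\nu_i(T_i)\ge\nu_i(T_j)$ for all $i,j$. **Theorem.** Let $\mathcal{T}$ be a tangle that is not homeomorphic to any of the six basic stringable tangles. Then there is a finite $n_0$ such that, for every $n$, if $\mathcal{T}$ guarantees envy-free connected allocations for $n$ agents, then $n\le n_0$. -/

import Mathlib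

open scoped unitInterval NNReal

/-- Instructions for gluing `m` disjoint copies of `[0,1]` along endpoints.  `G i = (a, b)` means
that the endpoint `0` of the `i`-th copy carries the label `a` and its endpoint `1` the label `b`;
two endpoints get identified exactly when their labels agree.  Every equivalence relation on the
`2m` endpoints arises in this way. -/
abbrev Gluing (m : ℕ) : Type := Fin m → ℕ × ℕ

namespace Gluing

/-- `G.IsEnd p a`: the point `p` of the disjoint union of the `m` copies of `[0,1]` is an endpoint
which carries the label `a`. -/
def IsEnd {m : ℕ} (G : Gluing m) (p : Fin m × I) (a : ℕ) : Prop :=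
  (p.2 = 0 ∧ a = (G p.1).1) ∨ (p.2 = 1 ∧ a = (G p.1).2)

theorem IsEnd.unique {m : ℕ} {G : Gluing m} {p : Fin m × I} {a b : ℕ}
    (ha : G.IsEnd p a) (hb : G.IsEnd p b) : a = b := by
  have h01 : (0 : I) ≠ 1 := zero_ne_one
  rcases ha with ⟨h, rfl⟩ | ⟨h, rfl⟩ <;> rcases hb with ⟨h', rfl⟩ | ⟨h', rfl⟩
  · rfl
  · exact absurd (h.symm.trans h') h01
  · exact absurd (h'.symm.trans h) h01
  · rfl

/-- The identification of endpoints with equal labels, as an equivalence relation on the disjoint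
union of `m` copies of `[0,1]`. -/
def setoid {m : ℕ} (G : Gluing m) : Setoid (Fin m × I) where
  r p q := p = q ∨ ∃ a, G.IsEnd p a ∧ G.IsEnd q a
  iseqv :=
    { refl := fun _ => Or.inl rfl
      symm := by
        rintro p q (rfl | ⟨a, hp, hq⟩)
        · exact Or.inl rfl
        · exact Or.inr ⟨a, hq, hp⟩
      trans := by
        rintro p q r (rfl | ⟨a, hp, hq⟩) (rfl | ⟨b, hq', hr⟩)
        · exact Or.inl rfl
        · exact Or.inr ⟨b, hq', hr⟩
        · exact Or.inr ⟨a, hp, hq⟩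
        · exact Or.inr ⟨a, hp, (hq.unique hq') ▸ hr⟩ }

/-- The space obtained from `m` disjoint copies of `[0,1]` by gluing according to `G`. -/
def Space {m : ℕ} (G : Gluing m) : Type := Quotient G.setoid

/-- The quotient topology. -/
instance {m : ℕ} (G : Gluing m) : TopologicalSpace G.Space :=
  inferInstanceAs (TopologicalSpace (Quotient G.setoid))

/-- The image in the glued space of the point `t` of the `i`-th copy of `[0,1]`. -/
def mk {m : ℕ} (G : Gluing m) (i : Fin m) (t : I) : G.Space := Quotient.mk G.setoid (i, t)

/-- A loop with a stick attached. -/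
def lollipop : Gluing 2 := ![(0, 0), (0, 1)]

/-- Two loops at one point. -/
def figureEight : Gluing 2 := ![(0, 0), (0, 0)]

/-- Two disjoint loops joined by a segment. -/
def handcuffs : Gluing 3 := ![(0, 0), (0, 1), (1, 1)]

/-- Three segments with common end points. -/
def theta : Gluing 3 := ![(0, 1), (0, 1), (0, 1)]

end Gluing

/-- A tangle: a connected (in particular nonempty) topological space that can be built from
finitely many disjoint copies of `[0,1]` by identifying some of their endpoints. -/
def IsTangle (T : Type*) [TopologicalSpace T] : Prop :=
  ConnectedSpace T ∧ ∃ (m : ℕ) (G : Gluing m), Nonempty (T ≃ₜ G.Space)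

/-- The six basic stringable tangles, up to homeomorphism. -/
def IsBasicStringable (T : Type*) [TopologicalSpace T] : Prop :=
  Nonempty (T ≃ₜ I) ∨ Nonempty (T ≃ₜ Circle) ∨
  Nonempty (T ≃ₜ Gluing.lollipop.Space) ∨ Nonempty (T ≃ₜ Gluing.figureEight.Space) ∨
  Nonempty (T ≃ₜ Gluing.handcuffs.Space) ∨ Nonempty (T ≃ₜ Gluing.theta.Space)

/-- The connected pieces of `T`; the empty piece counts as connected. -/
abbrev ConnectedPiece (T : Type*) [TopologicalSpace T] : Type _ := {X : Set T // IsPreconnected X}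

/-- Let `h` identify `T` with `m` copies of `[0,1]` glued at endpoints.  The closed piece with
coordinates `z = (x_i, y_i)_i` in `ℝ^{2m}` consists of the points of `[x_i, y_i] ∩ [0,1]` in
the `i`-th copy, for all `i`. -/
def closedPiece {T : Type*} [TopologicalSpace T] {m : ℕ} {G : Gluing m} (h : T ≃ₜ G.Space)
    (z : Fin m → ℝ × ℝ) : Set T :=
  {x | ∃ (i : Fin m) (t : I), (z i).1 ≤ (t : ℝ) ∧ (t : ℝ) ≤ (z i).2 ∧ h x = G.mk i t}

/-- Monotone continuous valuations on `T`.  Continuity: for every identification `h` of `T` with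
finitely many copies of `[0,1]` glued at endpoints, the value of the closed piece with coordinates
`z` depends continuously on those `z` for which this piece is connected.  (Edges may be cut into
several copies, so that every closed connected piece has coordinates for some `h`.) -/
structure MonotoneContinuousValuation (T : Type*) [TopologicalSpace T] where
  /-- The value of a connected piece. -/
  val : ConnectedPiece T → ℝ≥0
  val_empty : val ⟨∅, isPreconnected_empty⟩ = 0
  mono : ∀ X Y : ConnectedPiece T, X.1 ⊆ Y.1 → val X ≤ val Y
  cont : ∀ (m : ℕ) (G : Gluing m) (h : T ≃ₜ G.Space),
    Continuous fun z : {z : Fin m → ℝ × ℝ // IsPreconnected (closedPiece h z)} =>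
      val ⟨closedPiece h z.1, z.2⟩

/-- `A` allocates to each of the `n` agents a connected piece, and these pieces partition `T`. -/
structure IsAllocation {T : Type*} [TopologicalSpace T] {n : ℕ} (A : Fin n → ConnectedPiece T) :
    Prop where
  disjoint : ∀ i j, i ≠ j → Disjoint (A i).1 (A j).1
  cover : ⋃ i, (A i).1 = Set.univ

/-- `T` guarantees envy-free connected allocations for `n` agents: whatever monotone continuous
valuations the agents have, some allocation of connected pieces leaves no agent envious. -/
def GuaranteesEnvyFree (T : Type*) [TopologicalSpace T] (n : ℕ) : Prop :=
  ∀ ν : Fin n → MonotoneContinuousValuation T,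
    ∃ A : Fin n → ConnectedPiece T, IsAllocation A ∧
      ∀ i j, (ν i).val (A j) ≤ (ν i).val (A i)

/-! Write the tangle as a gluing with as few edges as possible, with `m` edges and `V` glued points
(labels carried by at least two endpoints). Everything depends on whether `m` exceeds `V + 1`.

If `m > k = V + 1` and `n > k`, give all agents the same valuation, namely length, with total length
`n`: each edge has length `k/m < 1`, and one edge gets `n - k` more. In an envy-free allocation all
pieces are equally long, hence of length at least 1. At most `V` pieces contain a glued point. Every
other piece lies in one edge, and rounding down the edge lengths leaves room for only `n - k` of
these. So there are at most `V + (n - k) = n - 1` pieces, which is absurd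
(`le_of_guaranteesEnvyFree`).

If `m ≤ V + 1` and `m ≥ 2`, minimality makes at least three ends meet at each glued point
(`IsMinimal.three_le_card_ends`), because a point where only two ends meet could be erased. Counting
ends gives `3V ≤ 2m`, so `m ≤ 3`, and the few remaining gluings are the basic stringable ones
(`IsMinimal.isBasicStringable`). -/

open MeasureTheory Filter Topology

/-! ### Topology of glued spaces and their open edges. -/

namespace Gluing

variable {m : ℕ}

/-- The label at the endpoint `1` (for `true`) or `0` (for `false`) of an edge. -/
def lab (G : Gluing m) (p : Fin m × Bool) : ℕ := bif p.2 then (G p.1).2 else (G p.1).1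

/-- The endpoint of `[0,1]` encoded by a boolean. -/
def endPt (b : Bool) : I := bif b then 1 else 0

theorem isEnd_iff {G : Gluing m} {i : Fin m} {t : I} {a : ℕ} :
    G.IsEnd (i, t) a ↔ ∃ b, t = endPt b ∧ G.lab (i, b) = a := by
  simp [IsEnd, endPt, lab, eq_comm]

theorem mk_eq_mk_iff {G : Gluing m} {i j : Fin m} {s t : I} :
    G.mk i s = G.mk j t ↔
      (i = j ∧ s = t) ∨ ∃ b c, s = endPt b ∧ t = endPt c ∧ G.lab (i, b) = G.lab (j, c) := by
  have h : G.mk i s = G.mk j t ↔ ((i, s) = (j, t) ∨ ∃ a, G.IsEnd (i, s) a ∧ G.IsEnd (j, t) a) :=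
    Quotient.eq (r := G.setoid)
  rw [h, Prod.mk_inj]
  refine or_congr Iff.rfl ?_
  simp only [isEnd_iff]
  constructor
  · rintro ⟨a, ⟨b, hb, hb'⟩, c, hc, hc'⟩
    exact ⟨b, c, hb, hc, hb'.trans hc'.symm⟩
  · rintro ⟨b, c, hb, hc, h⟩
    exact ⟨_, ⟨b, hb, rfl⟩, c, hc, h.symm⟩

theorem exists_mk (G : Gluing m) (x : G.Space) : ∃ i t, G.mk i t = x := by
  obtain ⟨⟨i, t⟩, rfl⟩ := Quotient.exists_rep x
  exact ⟨i, t, rfl⟩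

theorem isOpen_iff_slices {S : Set (Fin m × I)} :
    IsOpen S ↔ ∀ i, IsOpen (Prod.mk i ⁻¹' S) := by
  constructor
  · intro h i
    exact h.preimage (by fun_prop)
  · intro h
    have : S = ⋃ i, {i} ×ˢ (Prod.mk i ⁻¹' S) := by
      ext ⟨j, t⟩
      simp
    rw [this]
    exact isOpen_iUnion fun i => (isOpen_discrete _).prod (h i)

theorem isOpen_iff {G : Gluing m} {S : Set G.Space} : IsOpen S ↔ ∀ i, IsOpen (G.mk i ⁻¹' S) := by
  have : IsOpen S ↔ IsOpen ((Quotient.mk G.setoid) ⁻¹' S) :=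
    (isQuotientMap_quotient_mk' (s := G.setoid)).isOpen_preimage.symm
  rw [this, isOpen_iff_slices]
  rfl

theorem isClosed_iff {G : Gluing m} {S : Set G.Space} :
    IsClosed S ↔ ∀ i, IsClosed (G.mk i ⁻¹' S) := by
  simp only [← isOpen_compl_iff, isOpen_iff, Set.preimage_compl]

theorem continuous_mk (G : Gluing m) (i : Fin m) : Continuous (G.mk i) :=
  ⟨fun _ h => isOpen_iff.1 h i⟩

/-- Seen from any edge, the image of a closed set is that set itself (on its own edge) up to
finitely many endpoints. -/
theorem isClosedMap_mk (G : Gluing m) (i : Fin m) : IsClosedMap (G.mk i) := by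
  intro C hC
  rw [isClosed_iff]
  intro j
  have : G.mk j ⁻¹' (G.mk i '' C) =
      {t | j = i ∧ t ∈ C} ∪ (endPt '' {c | ∃ b, endPt b ∈ C ∧ G.lab (i, b) = G.lab (j, c)}) := by
    ext t
    simp only [Set.mem_preimage, Set.mem_image, mk_eq_mk_iff, Set.mem_union, Set.mem_ofPred_eq]
    constructor
    · rintro ⟨s, hs, ⟨rfl, rfl⟩ | ⟨b, c, rfl, rfl, h⟩⟩
      · exact .inl ⟨rfl, hs⟩
      · exact .inr ⟨c, ⟨b, hs, h⟩, rfl⟩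
    · rintro (⟨rfl, hs⟩ | ⟨c, ⟨b, hs, h⟩, rfl⟩)
      · exact ⟨t, hs, .inl ⟨rfl, rfl⟩⟩
      · exact ⟨_, hs, .inr ⟨b, c, rfl, rfl, h⟩⟩
  rw [this]
  refine IsClosed.union ?_ (Set.toFinite _).isClosed
  by_cases h : j = i <;> simp [h, hC]

/-- The endpoints which carry the label `a`. -/
def ends (G : Gluing m) (a : ℕ) : Finset (Fin m × Bool) := Finset.univ.filter fun p => G.lab p = a

/-- The labels that occur at two or more endpoints. -/
def innerLabels (G : Gluing m) : Finset ℕ :=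
  (Finset.univ.image G.lab).filter fun a => 2 ≤ (G.ends a).card

theorem mem_innerLabels_of_ne {G : Gluing m} {p q : Fin m × Bool} (hpq : p ≠ q)
    (h : G.lab p = G.lab q) : G.lab p ∈ G.innerLabels := by
  refine Finset.mem_filter.2 ⟨Finset.mem_image_of_mem _ (Finset.mem_univ _), ?_⟩
  exact Finset.one_lt_card.2 ⟨p, by simp [ends], q, by simp [ends, h], hpq⟩

/-- The points of an edge without those endpoints at which something is glued. -/
def openEdge (G : Gluing m) (i : Fin m) : Set I :=
  {t | ∀ b, t = endPt b → G.lab (i, b) ∉ G.innerLabels}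

theorem isOpen_openEdge (G : Gluing m) (i : Fin m) : IsOpen (G.openEdge i) := by
  have : G.openEdge i = (endPt '' {b | G.lab (i, b) ∈ G.innerLabels})ᶜ := by
    ext t
    simp only [openEdge, Set.mem_ofPred_eq, Set.mem_compl_iff, Set.mem_image, not_exists, not_and]
    exact ⟨fun h b hb e => h b e.symm hb, fun h b e hb => h b hb e.symm⟩
  rw [this]
  exact (Set.toFinite _).isClosed.isOpen_compl

theorem eq_of_mk_eq_of_mem_openEdge {G : Gluing m} {i j : Fin m} {s t : I}
    (hs : s ∈ G.openEdge i) (h : G.mk i s = G.mk j t) : i = j ∧ s = t := by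
  rcases mk_eq_mk_iff.1 h with h | ⟨b, c, rfl, rfl, hl⟩
  · exact h
  · by_cases hp : (i, b) = (j, c)
    · obtain ⟨rfl, rfl⟩ := Prod.mk_inj.1 hp
      exact ⟨rfl, rfl⟩
    · exact absurd (mem_innerLabels_of_ne hp hl) (hs b rfl)

theorem isOpen_image_mk {G : Gluing m} {i : Fin m} {O : Set I} (hO : IsOpen O)
    (h : O ⊆ G.openEdge i) : IsOpen (G.mk i '' O) := by
  rw [isOpen_iff]
  intro j
  have : G.mk j ⁻¹' (G.mk i '' O) = {t | i = j ∧ t ∈ O} := by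
    ext t
    constructor
    · rintro ⟨s, hs, e⟩
      obtain ⟨rfl, rfl⟩ := eq_of_mk_eq_of_mem_openEdge (h hs) e
      exact ⟨rfl, hs⟩
    · rintro ⟨rfl, ht⟩
      exact ⟨t, ht, rfl⟩
  rw [this]
  by_cases hij : i = j <;> simp [hij, hO]

/-- A connected set without glued points lies in a single open edge. -/
theorem exists_subset_image_openEdge {G : Gluing m} {X : Set G.Space} (hX : IsPreconnected X)
    (hne : X.Nonempty) (h : ∀ x ∈ X, ∃ i, ∃ t ∈ G.openEdge i, G.mk i t = x) :
    ∃ i, X ⊆ G.mk i '' G.openEdge i := by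
  obtain ⟨x, hx⟩ := hne
  obtain ⟨i, t, ht, rfl⟩ := h x hx
  have hop (j) : IsOpen (G.mk j '' G.openEdge j) :=
    isOpen_image_mk (G.isOpen_openEdge j) subset_rfl
  refine ⟨i, hX.subset_left_of_subset_union (v := ⋃ j ∈ {j | j ≠ i}, G.mk j '' G.openEdge j)
    (hop i) (isOpen_biUnion fun j _ => hop j) ?_ ?_ ⟨_, hx, t, ht, rfl⟩⟩
  · rw [Set.disjoint_left]
    rintro _ ⟨s, hs, rfl⟩ h'
    simp only [Set.mem_iUnion] at h'
    obtain ⟨j, hj, u, hu, e⟩ := h'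
    exact hj (eq_of_mk_eq_of_mem_openEdge hu e).1
  · intro y hy
    obtain ⟨j, s, hs, rfl⟩ := h y hy
    by_cases hj : j = i
    · subst hj
      exact .inl ⟨s, hs, rfl⟩
    · exact .inr (Set.mem_biUnion (x := j) hj ⟨s, hs, rfl⟩)

/-- An open edge is openly embedded, so connectedness pulls back to it, and connected subsets of
`[0,1]` are order-convex. Measurability is what makes lengths of disjoint pieces add up. -/
theorem measurableSet_preimage_mk {G : Gluing m} {X : Set G.Space} {i : Fin m}
    (hX : IsPreconnected X) (h : X ⊆ G.mk i '' G.openEdge i) : MeasurableSet (G.mk i ⁻¹' X) := by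
  let f : G.openEdge i → G.Space := fun t => G.mk i t
  have hf : IsPreconnected (f ⁻¹' X) := by
    refine hX.preimage_of_isOpenMap ?_ ?_ ?_
    · intro s t hst
      exact Subtype.ext (eq_of_mk_eq_of_mem_openEdge s.2 hst).2
    · intro O hO
      have : f '' O = G.mk i '' (Subtype.val '' O) := by
        rw [Set.image_image]
      rw [this]
      refine isOpen_image_mk ((G.isOpen_openEdge i).isOpenMap_subtype_val O hO) ?_
      rintro _ ⟨t, -, rfl⟩
      exact t.2
    · intro x hx
      obtain ⟨t, ht, rfl⟩ := h hx
      exact ⟨⟨t, ht⟩, rfl⟩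
  have he : G.mk i ⁻¹' X = Subtype.val '' (f ⁻¹' X) := by
    ext t
    constructor
    · intro ht
      obtain ⟨s, hs, e⟩ := h ht
      obtain ⟨-, rfl⟩ := eq_of_mk_eq_of_mem_openEdge hs e
      exact ⟨⟨s, hs⟩, ht, rfl⟩
    · rintro ⟨s, hs, rfl⟩
      exact hs
  rw [he]
  exact ((hf.image _ continuous_subtype_val.continuousOn).ordConnected).measurableSet

end Gluing

/-! ### Length valuations and the bound on the number of agents. -/

section Valuation

variable {T : Type*} [TopologicalSpace T] {m : ℕ} {G : Gluing m}

theorem isClosed_closedPiece (h : T ≃ₜ G.Space) (z : Fin m → ℝ × ℝ) :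
    IsClosed (closedPiece h z) := by
  have : closedPiece h z =
      h ⁻¹' ⋃ i, G.mk i '' {t : I | (z i).1 ≤ (t : ℝ) ∧ (t : ℝ) ≤ (z i).2} := by
    ext x
    simp [closedPiece, and_assoc, eq_comm]
  rw [this]
  refine IsClosed.preimage h.continuous (isClosed_iUnion_of_finite fun i =>
    G.isClosedMap_mk i _ ?_)
  exact (isClosed_le continuous_const continuous_subtype_val).inter
    (isClosed_le continuous_subtype_val continuous_const)

/-- The part of `[0,1]` that is mapped into a closed piece changes continuously with the
coordinates of the piece, in measure. -/
theorem tendsto_volume_preimage_closedPiece (h : T ≃ₜ G.Space) {γ : I → T} (hγ : Continuous γ)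
    (hfin : ∀ x, (γ ⁻¹' {x}).Finite) (z : Fin m → ℝ × ℝ) :
    Tendsto (fun z' => volume (γ ⁻¹' closedPiece h z')) (𝓝 z)
      (𝓝 (volume (γ ⁻¹' closedPiece h z))) := by
  have hmeas (z') : MeasurableSet (γ ⁻¹' closedPiece h z') :=
    ((isClosed_closedPiece h z').preimage hγ).measurableSet
  refine tendsto_measure_of_ae_tendsto_indicator_of_isFiniteMeasure _ (hmeas z) hmeas ?_
  -- Away from these finitely many points, membership in the closed piece is decided on a single
  -- edge by strict inequalities, so it is unaffected by small changes of `z`.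
  let bad : Set T := ⋃ i, (fun t => h.symm (G.mk i t)) ''
    {t : I | (t : ℝ) ∈ ({0, 1, (z i).1, (z i).2} : Set ℝ)}
  have hbad : bad.Finite := Set.finite_iUnion fun i => Set.Finite.image _
    (Set.Finite.preimage Subtype.val_injective.injOn (Set.toFinite _))
  have hnull : volume (γ ⁻¹' bad) = 0 := by
    have : (γ ⁻¹' bad).Finite := hbad.preimage' fun x _ => hfin x
    exact this.measure_zero _
  filter_upwards [measure_eq_zero_iff_ae_notMem.1 hnull] with t ht
  obtain ⟨i, s, hs⟩ := G.exists_mk (h (γ t))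
  have hs' : (s : ℝ) ∉ ({0, 1, (z i).1, (z i).2} : Set ℝ) := fun hm =>
    ht (Set.mem_iUnion.2 ⟨i, s, hm, by simp [hs]⟩)
  simp only [Set.mem_insert_iff, Set.mem_singleton_iff, not_or] at hs'
  have key (z') : t ∈ γ ⁻¹' closedPiece h z' ↔ (z' i).1 ≤ (s : ℝ) ∧ (s : ℝ) ≤ (z' i).2 := by
    constructor
    · rintro ⟨j, u, h1, h2, e⟩
      rcases Gluing.mk_eq_mk_iff.1 (hs.trans e) with ⟨rfl, rfl⟩ | ⟨b, -, rfl, -⟩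
      · exact ⟨h1, h2⟩
      · cases b <;> simp [Gluing.endPt] at hs'
    · rintro ⟨h1, h2⟩
      exact ⟨i, s, h1, h2, hs.symm⟩
  simp only [key]
  have c1 : Tendsto (fun z' : Fin m → ℝ × ℝ => (z' i).1) (𝓝 z) (𝓝 (z i).1) :=
    (continuous_fst.comp (continuous_apply i)).tendsto z
  have c2 : Tendsto (fun z' : Fin m → ℝ × ℝ => (z' i).2) (𝓝 z) (𝓝 (z i).2) :=
    (continuous_snd.comp (continuous_apply i)).tendsto z
  rcases lt_or_gt_of_ne hs'.2.2.1 with h1 | h1 <;> rcases lt_or_gt_of_ne hs'.2.2.2 with h2 | h2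
  · filter_upwards [c1.eventually (lt_mem_nhds h1)] with z' hz
    exact iff_of_false (fun H => absurd H.1 (not_le.2 hz)) fun H => absurd H.1 (not_le.2 h1)
  · filter_upwards [c1.eventually (lt_mem_nhds h1)] with z' hz
    exact iff_of_false (fun H => absurd H.1 (not_le.2 hz)) fun H => absurd H.1 (not_le.2 h1)
  · filter_upwards [c1.eventually (gt_mem_nhds h1), c2.eventually (lt_mem_nhds h2)] with z' hz hz'
    exact iff_of_true ⟨hz.le, hz'.le⟩ ⟨h1.le, h2.le⟩
  · filter_upwards [c2.eventually (gt_mem_nhds h2)] with z' hz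
    exact iff_of_false (fun H => absurd H.2 (not_le.2 hz)) fun H => absurd H.2 (not_le.2 h2)

theorem Gluing.finite_preimage_mk (G : Gluing m) (i : Fin m) (x : G.Space) :
    (G.mk i ⁻¹' {x}).Finite := by
  by_cases hx : ∃ s, G.mk i s = x
  · obtain ⟨s, rfl⟩ := hx
    refine (Set.toFinite ({s} ∪ Set.range Gluing.endPt)).subset ?_
    intro t ht
    rcases Gluing.mk_eq_mk_iff.1 ht with ⟨-, rfl⟩ | ⟨b, -, rfl, -⟩
    · exact .inl rfl
    · exact .inr ⟨b, rfl⟩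
  · refine Set.finite_empty.subset fun t ht => hx ⟨t, ht⟩

/-- Total length of a set when the `i`-th edge has length `w i`. -/
noncomputable def edgeLength (h : T ≃ₜ G.Space) (w : Fin m → ℝ≥0) (X : Set T) : ℝ≥0 :=
  ∑ i, w i * (volume ((fun t => h.symm (G.mk i t)) ⁻¹' X)).toNNReal

theorem volume_toNNReal_mono {A B : Set I} (h : A ⊆ B) :
    (volume A).toNNReal ≤ (volume B).toNNReal :=
  ENNReal.toNNReal_mono (measure_ne_top _ _) (measure_mono h)

/-- The length as a monotone continuous valuation. -/
noncomputable def lengthValuation (h : T ≃ₜ G.Space) (w : Fin m → ℝ≥0) :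
    MonotoneContinuousValuation T where
  val X := edgeLength h w X.1
  val_empty := by simp [edgeLength]
  mono X Y hXY := Finset.sum_le_sum fun i _ =>
    mul_le_mul_right (volume_toNNReal_mono (Set.preimage_mono hXY)) _
  cont m' G' h' := by
    -- The identification `h'` is unrelated to `h`; each edge of `h` enters only as a curve with
    -- finite fibres.
    refine continuous_finsetSum _ fun i _ => continuous_const.mul ?_
    rw [continuous_iff_continuousAt]
    intro z
    refine (ENNReal.tendsto_toNNReal (measure_ne_top _ _)).comp ?_
    refine (tendsto_volume_preimage_closedPiece h' (γ := fun t => h.symm (G.mk i t))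
      (h.symm.continuous.comp (G.continuous_mk i)) (fun x => ?_) z.1).comp
      (continuous_subtype_val.tendsto z)
    have : (fun t => h.symm (G.mk i t)) ⁻¹' {x} = G.mk i ⁻¹' {h x} := by
      ext t
      simp [Homeomorph.symm_apply_eq]
    rw [this]
    exact G.finite_preimage_mk i _

theorem edgeLength_univ (h : T ≃ₜ G.Space) (w : Fin m → ℝ≥0) :
    edgeLength h w Set.univ = ∑ i, w i := by
  simp [edgeLength]

/-- Subadditivity holds for outer measure, so no measurability of the pieces is needed here. -/
theorem edgeLength_iUnion_le (h : T ≃ₜ G.Space) (w : Fin m → ℝ≥0) {n : ℕ} (A : Fin n → Set T) :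
    edgeLength h w (⋃ j, A j) ≤ ∑ j, edgeLength h w (A j) := by
  unfold edgeLength
  rw [Finset.sum_comm]
  refine Finset.sum_le_sum fun i _ => ?_
  rw [← Finset.mul_sum]
  refine mul_le_mul_right ?_ _
  rw [← ENNReal.toNNReal_sum fun j _ => measure_ne_top _ _, Set.preimage_iUnion]
  refine ENNReal.toNNReal_mono (ENNReal.sum_ne_top.2 fun j _ => measure_ne_top _ _) ?_
  exact measure_iUnion_fintype_le _ _

theorem edgeLength_eq_of_subset (h : T ≃ₜ G.Space) (w : Fin m → ℝ≥0) {X : Set T} {i : Fin m}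
    (hX : h '' X ⊆ G.mk i '' G.openEdge i) :
    edgeLength h w X = w i * (volume ((fun t => h.symm (G.mk i t)) ⁻¹' X)).toNNReal := by
  refine Finset.sum_eq_single i (fun j _ hj => ?_) (by simp)
  have : (fun t => h.symm (G.mk j t)) ⁻¹' X = ∅ := by
    refine Set.eq_empty_of_forall_notMem fun t ht => ?_
    obtain ⟨s, hs, e⟩ := hX ⟨_, ht, rfl⟩
    exact hj (Gluing.eq_of_mk_eq_of_mem_openEdge hs (e.trans (h.apply_symm_apply _))).1.symm
  simp [this]

/-- Disjoint connected pieces inside one open edge have total length at most that of the edge. -/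
theorem sum_edgeLength_le (h : T ≃ₜ G.Space) (w : Fin m → ℝ≥0) {n : ℕ}
    {A : Fin n → ConnectedPiece T} (hA : IsAllocation A) (i : Fin m) (s : Finset (Fin n))
    (hs : ∀ j ∈ s, h '' (A j).1 ⊆ G.mk i '' G.openEdge i) :
    ∑ j ∈ s, edgeLength h w (A j).1 ≤ w i := by
  rw [Finset.sum_congr rfl fun j hj => edgeLength_eq_of_subset h w (hs j hj), ← Finset.mul_sum,
    ← ENNReal.toNNReal_sum fun j _ => measure_ne_top _ _, ← measure_biUnion_finset]
  · calc _ ≤ w i * 1 := by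
          refine mul_le_mul_right ?_ _
          rw [← ENNReal.toNNReal_one]
          exact ENNReal.toNNReal_mono ENNReal.one_ne_top prob_le_one
      _ = w i := mul_one _
  · intro j _ k _ hjk
    exact (hA.disjoint j k hjk).preimage _
  · intro j hj
    have : (fun t => h.symm (G.mk i t)) ⁻¹' (A j).1 = G.mk i ⁻¹' (h '' (A j).1) := by
      rw [h.image_eq_preimage_symm]
      rfl
    rw [this]
    exact Gluing.measurableSet_preimage_mk ((A j).2.image _ h.continuous.continuousOn) (hs j hj)

/-- At most one piece for each glued label contains a glued point. -/
theorem card_pieces_with_innerLabel_le (h : T ≃ₜ G.Space) {n : ℕ} {A : Fin n → ConnectedPiece T}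
    (hA : IsAllocation A) (s : Finset (Fin n))
    (hs : ∀ j ∈ s, ∃ p, G.lab p ∈ G.innerLabels ∧
      h.symm (G.mk p.1 (Gluing.endPt p.2)) ∈ (A j).1) :
    s.card ≤ G.innerLabels.card := by
  rcases s.eq_empty_or_nonempty with rfl | ⟨j₀, hj₀⟩
  · simp
  have : Nonempty (Fin m × Bool) := ⟨(hs j₀ hj₀).choose⟩
  choose! p hp hpA using hs
  refine Finset.card_le_card_of_injOn (fun j => G.lab (p j)) (fun j hj => hp j hj) ?_
  intro j hj k hk e
  by_contra hjk
  refine Set.disjoint_left.1 (hA.disjoint j k hjk) (hpA j hj) ?_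
  have : G.mk (p j).1 (Gluing.endPt (p j).2) = G.mk (p k).1 (Gluing.endPt (p k).2) :=
    Gluing.mk_eq_mk_iff.2 (.inr ⟨_, _, rfl, rfl, e⟩)
  rw [this]
  exact hpA k hk

/-- Pigeonhole: the edge lengths are chosen so that rounding them down wastes a total of `k`, while
the glued points make up for only `k - 1` pieces. -/
theorem le_of_guaranteesEnvyFree (h : T ≃ₜ G.Space) (hm : G.innerLabels.card + 1 < m) {n : ℕ}
    (hn : GuaranteesEnvyFree T n) : n ≤ G.innerLabels.card + 1 := by
  by_contra! hlt
  set k := G.innerLabels.card + 1 with hk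
  have hm0 : 0 < m := by omega
  have : NeZero m := ⟨hm0.ne'⟩
  -- `c i` is the number of pieces of length at least 1 that fit inside edge `i`; the surplus `k / m
  -- < 1` has no room for another.
  let c : Fin m → ℕ := Pi.single 0 (n - k)
  have hc : ∑ i, c i = n - k := by simp [c]
  let w : Fin m → ℝ≥0 := fun i => c i + k / m
  have hw (i) : w i < c i + 1 := by
    have : (k : ℝ≥0) / m < 1 := by
      rw [div_lt_one (by exact_mod_cast hm0)]
      exact_mod_cast hm
    exact add_lt_add_right this _
  have hwsum : ∑ i, w i = n := by
    have : (m : ℝ≥0) ≠ 0 := by exact_mod_cast hm0.ne'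
    simp only [w, Finset.sum_add_distrib, Finset.sum_const, Finset.card_univ, Fintype.card_fin,
      nsmul_eq_mul, mul_div_cancel₀ _ this]
    rw [← Nat.cast_sum, hc, ← Nat.cast_add, Nat.sub_add_cancel hlt.le]
  obtain ⟨A, hA, hEF⟩ := hn fun _ => lengthValuation h w
  replace hEF : ∀ i j, edgeLength h w (A j).1 ≤ edgeLength h w (A i).1 := hEF
  have hone (j) : 1 ≤ edgeLength h w (A j).1 := by
    -- No piece is longer than the `j`-th, so all would be shorter than 1 and could not cover total
    -- length `n`.
    by_contra! hj
    have h1 : (n : ℝ≥0) ≤ ∑ i, edgeLength h w (A i).1 := by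
      rw [← hwsum, ← edgeLength_univ h w, ← hA.cover]
      exact edgeLength_iUnion_le h w _
    have h2 : ∑ i, edgeLength h w (A i).1 < ∑ i : Fin n, (1 : ℝ≥0) :=
      Finset.sum_lt_sum_of_nonempty ⟨j, Finset.mem_univ j⟩ fun i _ => (hEF j i).trans_lt hj
    simp at h2
    exact absurd h1 (not_le.2 h2)
  classical
  let s : Finset (Fin n) := Finset.univ.filter fun j => ∃ p, G.lab p ∈ G.innerLabels ∧
      h.symm (G.mk p.1 (Gluing.endPt p.2)) ∈ (A j).1
  have hs : s.card ≤ G.innerLabels.card :=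
    card_pieces_with_innerLabel_le h hA s fun j hj => (Finset.mem_filter.1 hj).2
  have hex (j) (hj : j ∈ sᶜ) : ∃ i, h '' (A j).1 ⊆ G.mk i '' G.openEdge i := by
    refine Gluing.exists_subset_image_openEdge ((A j).2.image _ h.continuous.continuousOn) ?_ ?_
    · refine Set.Nonempty.image _ (Set.nonempty_iff_ne_empty.2 fun h0 => ?_)
      have := hone j
      rw [h0] at this
      simp [edgeLength] at this
    · rintro _ ⟨x, hx, rfl⟩
      obtain ⟨i, t, e⟩ := G.exists_mk (h x)
      refine ⟨i, t, fun b hb hlab => ?_, e⟩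
      refine (Finset.mem_compl.1 hj) (Finset.mem_filter.2 ⟨Finset.mem_univ _, (i, b), hlab, ?_⟩)
      simpa [← hb, e] using hx
  choose! f hf using hex
  have hfib (i) : {j ∈ sᶜ | f j = i}.card ≤ c i := by
    have h1 : (({j ∈ sᶜ | f j = i}.card : ℕ) : ℝ≥0) ≤ w i := by
      refine le_trans ?_ (sum_edgeLength_le h w hA i {j ∈ sᶜ | f j = i} fun j hj => ?_)
      · rw [Finset.card_eq_sum_ones, Nat.cast_sum]
        exact Finset.sum_le_sum fun j _ => by simpa using hone j
      · obtain ⟨hj', rfl⟩ := Finset.mem_filter.1 hj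
        exact hf j hj'
    have h2 := h1.trans_lt (hw i)
    exact Nat.lt_succ_iff.1 (by exact_mod_cast h2)
  have hcompl : sᶜ.card ≤ n - k := by
    rw [Finset.card_eq_sum_card_fiberwise (f := f) (t := Finset.univ) (fun _ _ => by simp), ← hc]
    exact Finset.sum_le_sum fun i _ => hfib i
  -- The two bounds add up to `(k - 1) + (n - k) < n`.
  have := s.card_add_card_compl
  rw [Fintype.card_fin] at this
  omega

end Valuation

/-! ### Different gluings of the same space. -/

namespace Gluing

variable {m : ℕ}

/-- A parametrization of a space by the edges of a gluing which identifies exactly the points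
that the gluing identifies. -/
theorem nonempty_homeomorph_of_edges {Y : Type*} [TopologicalSpace Y] (G : Gluing m)
    (f : Fin m → I → Y) (hcont : ∀ i, Continuous (f i)) (hclosed : ∀ i, IsClosedMap (f i))
    (hsurj : ∀ y, ∃ i t, f i t = y) (hker : ∀ i j s t, f i s = f j t ↔ G.mk i s = G.mk j t) :
    Nonempty (G.Space ≃ₜ Y) := by
  let F : C(Fin m × I, Y) := ⟨fun p => f p.1 p.2, ⟨fun S hS =>
    isOpen_iff_slices.2 fun i => hS.preimage (hcont i)⟩⟩
  have hF : IsClosedMap F := by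
    intro C hC
    have : F '' C = ⋃ i, f i '' (Prod.mk i ⁻¹' C) := by
      ext y
      simp [F]
    rw [this]
    exact isClosed_iUnion_of_finite fun i => hclosed i _ (hC.preimage (by fun_prop))
  have hq : IsQuotientMap F := hF.isQuotientMap F.continuous fun y => by
    obtain ⟨i, t, rfl⟩ := hsurj y
    exact ⟨(i, t), rfl⟩
  have key : ∀ s : Setoid (Fin m × I), s = Setoid.ker F → Nonempty (Quotient s ≃ₜ Y) := by
    rintro _ rfl
    exact ⟨hq.homeomorph⟩
  refine key G.setoid (Setoid.ext fun p q => ?_)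
  rw [Setoid.ker_def]
  exact Quotient.eq.symm.trans (hker p.1 q.1 p.2 q.2).symm

/-- `[0,1]` traversed backwards if `b` is `true`. -/
def orient (b : Bool) (t : I) : I := bif b then σ t else t

theorem orient_orient (b : Bool) (t : I) : orient b (orient b t) = t := by
  cases b <;> simp [orient]

theorem orient_endPt (b c : Bool) : orient b (endPt c) = endPt (c ^^ b) := by
  cases b <;> cases c <;> simp [orient, endPt]

theorem continuous_orient (b : Bool) : Continuous (orient b) := by
  cases b
  · exact continuous_id
  · exact unitInterval.continuous_symm

/-- Renumbering edges, changing their orientation and renaming labels does not change the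
glued space. -/
theorem nonempty_homeomorph_of_lab {m' : ℕ} {G : Gluing m} {G' : Gluing m'} (e : Fin m ≃ Fin m')
    (ε : Fin m → Bool)
    (h : ∀ p q : Fin m × Bool, G.lab p = G.lab q ↔
      G'.lab (e p.1, p.2 ^^ ε p.1) = G'.lab (e q.1, q.2 ^^ ε q.1)) :
    Nonempty (G.Space ≃ₜ G'.Space) := by
  have hend (b c : Bool) (t : I) : orient b t = endPt c ↔ t = endPt (c ^^ b) := by
    rw [← orient_endPt]
    constructor
    · intro h
      rw [← h, orient_orient]
    · rintro rfl
      rw [orient_orient]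
  refine G.nonempty_homeomorph_of_edges (fun i t => G'.mk (e i) (orient (ε i) t))
    (fun i => (G'.continuous_mk _).comp (continuous_orient _))
    (fun i => (G'.isClosedMap_mk _).comp (continuous_orient _).isClosedMap) (fun y => ?_)
    (fun i j s t => ?_)
  · obtain ⟨i, t, rfl⟩ := G'.exists_mk y
    exact ⟨e.symm i, orient (ε (e.symm i)) t, by simp [orient_orient]⟩
  · rw [mk_eq_mk_iff, mk_eq_mk_iff]
    refine or_congr ?_ ⟨?_, ?_⟩
    · constructor
      · rintro ⟨h1, h2⟩
        obtain rfl := e.injective h1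
        refine ⟨rfl, ?_⟩
        rw [← orient_orient (ε i) s, h2, orient_orient]
      · rintro ⟨rfl, rfl⟩
        exact ⟨rfl, rfl⟩
    · rintro ⟨b, c, hb, hc, hl⟩
      refine ⟨_, _, (hend _ _ _).1 hb, (hend _ _ _).1 hc, (h (i, b ^^ ε i) (j, c ^^ ε j)).2 ?_⟩
      simpa using hl
    · rintro ⟨b, c, rfl, rfl, hl⟩
      exact ⟨_, _, orient_endPt _ _, orient_endPt _ _, (h (i, b) (j, c)).1 hl⟩

/-- The first half of `[0,1]`. -/
noncomputable def firstHalf (t : I) : I :=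
  ⟨t / 2, by linarith [t.2.1], by linarith [t.2.2]⟩

/-- The second half of `[0,1]`. -/
noncomputable def secondHalf (t : I) : I :=
  ⟨(1 + t) / 2, by linarith [t.2.1], by linarith [t.2.2]⟩

theorem firstHalf_inj {s t : I} : firstHalf s = firstHalf t ↔ s = t := by
  simp only [firstHalf, Subtype.ext_iff]
  constructor <;> intro h <;> linarith

theorem secondHalf_inj {s t : I} : secondHalf s = secondHalf t ↔ s = t := by
  simp only [secondHalf, Subtype.ext_iff]
  constructor <;> intro h <;> linarith

theorem firstHalf_eq_secondHalf {s t : I} : firstHalf s = secondHalf t ↔ s = 1 ∧ t = 0 := by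
  simp only [firstHalf, secondHalf, Subtype.ext_iff, Set.Icc.coe_one,
    Set.Icc.coe_zero]
  have := s.2.2
  have := t.2.1
  constructor
  · intro h
    constructor <;> linarith
  · rintro ⟨h, h'⟩
    linarith

theorem firstHalf_eq_zero {s : I} : firstHalf s = 0 ↔ s = 0 := by
  simp only [firstHalf, Subtype.ext_iff, Set.Icc.coe_zero]
  constructor <;> intro h <;> linarith

theorem firstHalf_ne_one {s : I} : firstHalf s ≠ 1 := by
  simp only [firstHalf, ne_eq, Subtype.ext_iff, Set.Icc.coe_one]
  linarith [s.2.2]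

theorem secondHalf_eq_one {s : I} : secondHalf s = 1 ↔ s = 1 := by
  simp only [secondHalf, Subtype.ext_iff, Set.Icc.coe_one]
  constructor <;> intro h <;> linarith

theorem secondHalf_ne_zero {s : I} : secondHalf s ≠ 0 := by
  simp only [secondHalf, ne_eq, Subtype.ext_iff, Set.Icc.coe_zero]
  linarith [s.2.1]

theorem continuous_firstHalf : Continuous firstHalf := by
  unfold firstHalf
  fun_prop

theorem continuous_secondHalf : Continuous secondHalf := by
  unfold secondHalf
  fun_prop

theorem exists_half (t : I) : (∃ s, firstHalf s = t) ∨ ∃ s, secondHalf s = t := by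
  rcases le_total (t : ℝ) (1 / 2) with h | h
  · exact .inl ⟨⟨2 * t, by linarith [t.2.1], by linarith⟩, Subtype.ext (by simp [firstHalf])⟩
  · exact .inr ⟨⟨2 * t - 1, by linarith, by linarith [t.2.2]⟩,
      Subtype.ext (by simp [secondHalf])⟩

/-- Two edges in succession can be merged if nothing else is attached where they meet. -/
theorem exists_homeomorph_merge {k : ℕ} (G : Gluing (k + 2))
    (h : ∀ p, G.lab p = (G 0).2 ↔ p = (0, true) ∨ p = (1, false)) :
    ∃ G' : Gluing (k + 1), Nonempty (G.Space ≃ₜ G'.Space) := by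
  let G' : Gluing (k + 1) := Fin.cons ((G 0).1, (G 1).2) fun l => G l.succ.succ
  have h0 : (G 0).1 ≠ (G 0).2 := fun e => by simpa using (h (0, false)).1 e
  have h1 : (G 1).2 ≠ (G 0).2 := fun e => by simpa using (h (1, true)).1 e
  have h2 : (G 1).1 = (G 0).2 := (h (1, false)).2 (.inr rfl)
  have h3 (l : Fin k) : (G l.succ.succ).1 ≠ (G 0).2 := fun e => by
    simpa [Fin.ext_iff] using (h (l.succ.succ, false)).1 e
  have h4 (l : Fin k) : (G l.succ.succ).2 ≠ (G 0).2 := fun e => by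
    simpa [Fin.ext_iff] using (h (l.succ.succ, true)).1 e
  let f : Fin (k + 2) → I → G'.Space :=
    Fin.cons (fun t => G'.mk 0 (firstHalf t))
      (Fin.cons (fun t => G'.mk 0 (secondHalf t)) fun l => G'.mk l.succ)
  have f0 : f 0 = fun t => G'.mk 0 (firstHalf t) := rfl
  have f1 : f 1 = fun t => G'.mk 0 (secondHalf t) := rfl
  have f2 (l : Fin k) : f l.succ.succ = G'.mk l.succ := rfl
  have hl (l : Fin k) : (0 : Fin (k + 2)) ≠ l.succ.succ := (Fin.succ_ne_zero _).symm
  have hl' (l : Fin k) : (1 : Fin (k + 2)) ≠ l.succ.succ := by simp [Fin.ext_iff]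
  have hg (l : Fin k) : (0 : Fin (k + 1)) ≠ l.succ := (Fin.succ_ne_zero _).symm
  have g0 : G' 0 = ((G 0).1, (G 1).2) := rfl
  have g1 (l : Fin k) : G' l.succ = G l.succ.succ := rfl
  refine ⟨G', G.nonempty_homeomorph_of_edges f ?_ ?_ ?_ ?_⟩
  · refine Fin.cases ?_ (Fin.cases ?_ ?_)
    · exact (G'.continuous_mk _).comp continuous_firstHalf
    · exact (G'.continuous_mk _).comp continuous_secondHalf
    · exact fun l => G'.continuous_mk _
  · refine Fin.cases ?_ (Fin.cases ?_ ?_)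
    · exact (G'.isClosedMap_mk _).comp continuous_firstHalf.isClosedMap
    · exact (G'.isClosedMap_mk _).comp continuous_secondHalf.isClosedMap
    · exact fun l => G'.isClosedMap_mk _
  · intro y
    obtain ⟨i, t, rfl⟩ := G'.exists_mk y
    induction i using Fin.cases with
    | zero =>
      rcases exists_half t with ⟨s, rfl⟩ | ⟨s, rfl⟩
      · exact ⟨0, s, rfl⟩
      · exact ⟨1, s, rfl⟩
    | succ l => exact ⟨l.succ.succ, t, rfl⟩
  · have c00 (s t) : f 0 s = f 0 t ↔ G.mk 0 s = G.mk 0 t := by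
      simp only [f0, mk_eq_mk_iff, Bool.exists_bool, endPt, lab, cond_true, cond_false,
        firstHalf_inj, firstHalf_eq_zero, firstHalf_ne_one, g0]
      grind
    have c11 (s t) : f 1 s = f 1 t ↔ G.mk 1 s = G.mk 1 t := by
      simp only [f1, mk_eq_mk_iff, Bool.exists_bool, endPt, lab, cond_true, cond_false,
        secondHalf_inj, secondHalf_eq_one, secondHalf_ne_zero, g0]
      grind
    have c01 (s t) : f 0 s = f 1 t ↔ G.mk 0 s = G.mk 1 t := by
      simp only [f0, f1, mk_eq_mk_iff, Bool.exists_bool, endPt, lab, cond_true, cond_false,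
        firstHalf_eq_secondHalf, firstHalf_eq_zero, firstHalf_ne_one, secondHalf_eq_one,
        secondHalf_ne_zero, g0, zero_ne_one]
      grind
    have c0l (l : Fin k) (s t) : f 0 s = f l.succ.succ t ↔ G.mk 0 s = G.mk l.succ.succ t := by
      simp only [f0, f2, mk_eq_mk_iff, Bool.exists_bool, endPt, lab, cond_true, cond_false,
        firstHalf_eq_zero, firstHalf_ne_one, g0, g1, hl, hg]
      grind
    have c1l (l : Fin k) (s t) : f 1 s = f l.succ.succ t ↔ G.mk 1 s = G.mk l.succ.succ t := by
      simp only [f1, f2, mk_eq_mk_iff, Bool.exists_bool, endPt, lab, cond_true, cond_false,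
        secondHalf_eq_one, secondHalf_ne_zero, g0, g1, hl', hg]
      grind
    have cll (l l' : Fin k) (s t) :
        f l.succ.succ s = f l'.succ.succ t ↔ G.mk l.succ.succ s = G.mk l'.succ.succ t := by
      simp only [f2, mk_eq_mk_iff, lab, g1, Fin.succ_inj]
    refine Fin.cases ?_ (Fin.cases ?_ fun l => ?_) <;>
      refine Fin.cases ?_ (Fin.cases ?_ fun l' => ?_) <;> intro s t
    · exact c00 s t
    · exact c01 s t
    · exact c0l l' s t
    · exact (eq_comm.trans (c01 t s)).trans eq_comm
    · exact c11 s t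
    · exact c1l l' s t
    · exact (eq_comm.trans (c0l l t s)).trans eq_comm
    · exact (eq_comm.trans (c1l l t s)).trans eq_comm
    · exact cll l l' s t

/-! ### Minimal gluings and the degrees of their glued points. -/

/-- The gluing has the least number of edges among all those with the same space. -/
def IsMinimal (G : Gluing m) : Prop :=
  ∀ (m' : ℕ) (G' : Gluing m'), Nonempty (G.Space ≃ₜ G'.Space) → m ≤ m'

/-- Two different edges meeting at a point with no third end there could be merged, which would save
an edge. -/
theorem IsMinimal.fst_eq_of_ends {G : Gluing m} (hG : G.IsMinimal) {p q : Fin m × Bool}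
    (h : ∀ r, G.lab r = G.lab p ↔ r = p ∨ r = q) : p.1 = q.1 := by
  by_contra hpq
  obtain ⟨k, rfl⟩ : ∃ k, m = k + 2 := by
    have := p.1.2
    have := q.1.2
    have : (p.1 : ℕ) ≠ q.1 := fun e => hpq (Fin.ext e)
    exact ⟨m - 2, by omega⟩
  obtain ⟨e, he0, he1⟩ : ∃ e : Fin (k + 2) ≃ Fin (k + 2), e p.1 = 0 ∧ e q.1 = 1 := by
    have hne : Equiv.swap p.1 0 q.1 ≠ 0 := by
      exact fun e => hpq (((Equiv.swap p.1 0).injective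
        (e.trans (Equiv.swap_apply_left _ _).symm)).symm)
    refine ⟨(Equiv.swap p.1 0).trans (Equiv.swap (Equiv.swap p.1 0 q.1) 1), ?_, ?_⟩
    · rw [Equiv.trans_apply, Equiv.swap_apply_left]
      exact Equiv.swap_apply_of_ne_of_ne hne.symm (by simp)
    · rw [Equiv.trans_apply, Equiv.swap_apply_left]
  -- Orients edge `p.1` to end, and edge `q.1` to start, at the common point.
  let ε : Fin (k + 2) → Bool := fun i => if i = p.1 then !p.2 else q.2
  have hp : ε p.1 = !p.2 := if_pos rfl
  have hq : ε q.1 = q.2 := if_neg (Ne.symm hpq)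
  let G₁ : Gluing (k + 2) := fun l =>
    (G.lab (e.symm l, ε (e.symm l)), G.lab (e.symm l, !ε (e.symm l)))
  have hlab (i b) : G₁.lab (i, b) = G.lab (e.symm i, b ^^ ε (e.symm i)) := by
    cases b <;> simp [lab, G₁]
  obtain ⟨φ⟩ : Nonempty (G.Space ≃ₜ G₁.Space) :=
    nonempty_homeomorph_of_lab e ε fun p q => by simp [hlab]
  have hp' : e.symm 0 = p.1 := by simp [← he0]
  have hq' : e.symm 1 = q.1 := by simp [← he1]
  have hmerge : ∀ r, G₁.lab r = (G₁ 0).2 ↔ r = (0, true) ∨ r = (1, false) := by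
    rintro ⟨i, b⟩
    have h0 : (G₁ 0).2 = G.lab p := by
      simp [G₁, hp', hp]
    rw [h0, hlab, h]
    refine or_congr ?_ ?_
    · rw [Prod.ext_iff, Prod.mk_inj, Equiv.symm_apply_eq, he0]
      refine and_congr_right ?_
      rintro rfl
      rw [hp', hp]
      cases b <;> simp
    · rw [Prod.ext_iff, Prod.mk_inj, Equiv.symm_apply_eq, he1]
      refine and_congr_right ?_
      rintro rfl
      rw [hq', hq]
      cases b <;> simp
  obtain ⟨G', ⟨ψ⟩⟩ := G₁.exists_homeomorph_merge hmerge
  have := hG _ G' ⟨φ.trans ψ⟩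
  omega

/-- An edge that is a component is everything. -/
theorem eq_of_isolated_loop {G : Gluing m} [ConnectedSpace G.Space] {i : Fin m}
    (h : ∀ b r, G.lab r = G.lab (i, b) → r.1 = i) (j : Fin m) : j = i := by
  have hpre (j) : G.mk j ⁻¹' Set.range (G.mk i) = {_t | j = i} := by
    ext t
    constructor
    · rintro ⟨s, hs⟩
      rcases mk_eq_mk_iff.1 hs with ⟨rfl, -⟩ | ⟨b, c, -, -, hl⟩
      · rfl
      · exact h b (j, c) hl.symm
    · rintro rfl
      exact ⟨t, rfl⟩
  -- The preimage of the range in each edge is everything or nothing.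
  have hclopen : IsClopen (Set.range (G.mk i)) := by
    rw [IsClopen, isClosed_iff, isOpen_iff]
    constructor <;> intro j <;> rw [hpre] <;> by_cases hj : j = i <;> simp [hj]
  have huniv := hclopen.eq_univ ⟨_, 0, rfl⟩
  have : (0 : I) ∈ G.mk j ⁻¹' Set.range (G.mk i) := by simp [huniv]
  rw [hpre] at this
  exact this

/-- If just two ends met, they would belong to one edge by minimality. That edge would be an
isolated circle, which connectedness excludes when `m ≥ 2`. -/
theorem IsMinimal.three_le_card_ends {G : Gluing m} (hG : G.IsMinimal) [ConnectedSpace G.Space]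
    (hm : 2 ≤ m) {a : ℕ} (ha : a ∈ G.innerLabels) : 3 ≤ (G.ends a).card := by
  have h2 := (Finset.mem_filter.1 ha).2
  by_contra! h3
  obtain ⟨p, q, hpq, he⟩ := Finset.card_eq_two.1 (by omega : (G.ends a).card = 2)
  have hmem (r) : G.lab r = a ↔ r = p ∨ r = q := by
    have : r ∈ G.ends a ↔ G.lab r = a := by simp [ends]
    rw [← this, he]
    simp
  have hp : G.lab p = a := (hmem p).2 (.inl rfl)
  have hfst : p.1 = q.1 := hG.fst_eq_of_ends (by rwa [hp])
  have hsnd : p.2 ≠ q.2 := fun e => hpq (Prod.ext hfst e)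
  have hall (b) : G.lab (p.1, b) = a := by
    rw [hmem]
    by_cases hb : b = p.2
    · exact .inl (by rw [hb])
    · refine .inr (Prod.ext hfst ?_)
      exact (Bool.eq_not.2 hb).trans (Bool.eq_not.2 hsnd.symm).symm
  have hiso := eq_of_isolated_loop (G := G) (i := p.1) fun b r hr => by
    rw [hall, hmem] at hr
    rcases hr with rfl | rfl
    · rfl
    · exact hfst.symm
  have := (hiso ⟨0, by omega⟩).trans (hiso ⟨1, by omega⟩).symm
  simp at this

/-- Double counting: the `2 * m` ends are distributed over the labels. -/
theorem three_mul_card_innerLabels_le {G : Gluing m}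
    (h : ∀ a ∈ G.innerLabels, 3 ≤ (G.ends a).card) : 3 * G.innerLabels.card ≤ 2 * m := by
  have hdisj : (G.innerLabels : Set ℕ).PairwiseDisjoint G.ends := by
    intro a _ b _ hab
    refine Finset.disjoint_left.2 fun p hp hq => hab ?_
    simp only [ends, Finset.mem_filter, Finset.mem_univ, true_and] at hp hq
    exact hp.symm.trans hq
  calc 3 * G.innerLabels.card = ∑ a ∈ G.innerLabels, 3 := by simp [mul_comm]
    _ ≤ ∑ a ∈ G.innerLabels, (G.ends a).card := Finset.sum_le_sum h
    _ = (G.innerLabels.biUnion G.ends).card := (Finset.card_biUnion hdisj).symm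
    _ ≤ Fintype.card (Fin m × Bool) := Finset.card_le_univ _
    _ = 2 * m := by simp [mul_comm]

/-! ### Gluings with at most three edges. -/

theorem nonempty_homeomorph_interval {G : Gluing 1} (h : (G 0).1 ≠ (G 0).2) :
    Nonempty (G.Space ≃ₜ I) := by
  refine G.nonempty_homeomorph_of_edges (fun _ t => t) (fun _ => continuous_id)
    (fun _ => IsClosedMap.id) (fun y => ⟨0, y, rfl⟩) fun i j s t => ?_
  rw [Subsingleton.elim i 0, Subsingleton.elim j 0, mk_eq_mk_iff]
  simp only [Bool.exists_bool, endPt, lab, cond_true, cond_false]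
  grind

theorem nonempty_homeomorph_circle {G : Gluing 1} (h : (G 0).1 = (G 0).2) :
    Nonempty (G.Space ≃ₜ Circle) := by
  have hc : Continuous fun t : I => Circle.exp (2 * Real.pi * t) := by fun_prop
  have hpi := Real.pi_pos
  refine G.nonempty_homeomorph_of_edges (fun _ t => Circle.exp (2 * Real.pi * t)) (fun _ => hc)
    (fun _ => hc.isClosedMap) (fun y => ?_) fun i j s t => ?_
  · refine ⟨0, ⟨Int.fract (Complex.arg y / (2 * Real.pi)), Int.fract_nonneg _,
      (Int.fract_lt_one _).le⟩, ?_⟩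
    rw [← Circle.exp_arg y, Circle.exp_eq_exp]
    refine ⟨-⌊Complex.arg y / (2 * Real.pi)⌋, ?_⟩
    simp only [Circle.exp_arg, Int.fract]
    push_cast
    field_simp
    ring
  · rw [Subsingleton.elim i 0, Subsingleton.elim j 0, mk_eq_mk_iff, Circle.exp_eq_exp]
    simp only [Bool.exists_bool, endPt, lab, cond_true, cond_false, h, Subtype.ext_iff,
      Set.Icc.coe_zero, Set.Icc.coe_one]
    have hs := s.2
    have ht := t.2
    constructor
    · rintro ⟨n, hn⟩
      have hn' : (s : ℝ) = t + n := by
        have : (2 * Real.pi) * (s : ℝ) = (2 * Real.pi) * (t + n) := by linarith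
        exact mul_left_cancel₀ (by positivity) this
      have h1 : n ≤ 1 := by
        have : (n : ℝ) ≤ 1 := by linarith [hs.2, ht.1]
        exact_mod_cast this
      have h2 : -1 ≤ n := by
        have : (-1 : ℝ) ≤ n := by linarith [hs.1, ht.2]
        exact_mod_cast this
      -- Parameters in `[0,1]` differ by an integer only if they are equal or are the two endpoints.
      obtain rfl | rfl | rfl : n = -1 ∨ n = 0 ∨ n = 1 := by omega
      · have a : (s : ℝ) = 0 := by push_cast at hn'; linarith [hs.1, ht.2]
        have b : (t : ℝ) = 1 := by push_cast at hn'; linarith [hs.1, ht.2]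
        simp [a, b]
      · simp [hn']
      · have a : (s : ℝ) = 1 := by push_cast at hn'; linarith [hs.2, ht.1]
        have b : (t : ℝ) = 0 := by push_cast at hn'; linarith [hs.2, ht.1]
        simp [a, b]
    · rintro (⟨-, e⟩ | (⟨e, e', -⟩ | ⟨e, e', -⟩) | (⟨e, e', -⟩ | ⟨e, e', -⟩))
      · exact ⟨0, by simp [e]⟩
      · exact ⟨0, by simp [e, e']⟩
      · exact ⟨-1, by simp [e, e']⟩
      · exact ⟨1, by simp [e, e']⟩
      · exact ⟨0, by simp [e, e']⟩

theorem nonempty_homeomorph_of_two_edges {G : Gluing 2} {a : ℕ} (h : 3 ≤ (G.ends a).card) :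
    Nonempty (G.Space ≃ₜ lollipop.Space) ∨ Nonempty (G.Space ≃ₜ figureEight.Space) := by
  by_cases hall : ∀ p, G.lab p = a
  · right
    refine nonempty_homeomorph_of_lab (Equiv.refl _) (fun _ => false) fun p q => ?_
    simp only [hall, true_iff]
    revert p q
    decide
  · left
    push Not at hall
    obtain ⟨r, hr⟩ := hall
    -- Of the four ends at least three carry `a`, so `r` is the only exception.
    have hother (p) (hp : p ≠ r) : G.lab p = a := by
      by_contra hpa
      have hsub : ({p, r} : Finset (Fin 2 × Bool)) ⊆ (G.ends a)ᶜ := by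
        intro x hx
        simp only [Finset.mem_insert, Finset.mem_singleton] at hx
        rcases hx with rfl | rfl <;> simpa [ends]
      have h1 := Finset.card_le_card hsub
      have h2 := (G.ends a).card_add_card_compl
      rw [Finset.card_pair hp] at h1
      have h4 : Fintype.card (Fin 2 × Bool) = 4 := by simp
      omega
    have hlab (p q) : G.lab p = G.lab q ↔ (p = r ↔ q = r) := by
      by_cases hp : p = r <;> by_cases hq : q = r
      · simp [hp, hq]
      · simp [hp, hq, hother q hq, hr]
      · simp [hp, hq, hother p hp, hr.symm]
      · simp [hp, hq, hother]
    -- Takes the free end `r` to the free end of the lollipop's stick, the endpoint `1` of edge `1`.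
    refine nonempty_homeomorph_of_lab (Equiv.swap r.1 1) (fun _ => !r.2) fun p q => ?_
    rw [hlab]
    clear * -
    revert p q r
    decide

/-- If every edge has both colours, the gluing is theta. Otherwise some edge has a single colour;
the 3–3 split then forces a second such edge of the other colour and a two-coloured third edge, the
handcuffs. -/
theorem theta_or_handcuffs_of_coloring : ∀ c : Fin 3 × Bool → Bool,
    (Finset.univ.filter fun p => c p = true).card = 3 →
      (∃ ε : Fin 3 → Bool, ∀ p q : Fin 3 × Bool, c p = c q ↔
        theta.lab (p.1, p.2 ^^ ε p.1) = theta.lab (q.1, q.2 ^^ ε q.1)) ∨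
      ∃ (e : Equiv.Perm (Fin 3)) (ε : Fin 3 → Bool), ∀ p q : Fin 3 × Bool, c p = c q ↔
        handcuffs.lab (e p.1, p.2 ^^ ε p.1) = handcuffs.lab (e q.1, q.2 ^^ ε q.1) := by
  decide +kernel

theorem nonempty_homeomorph_of_three_edges {G : Gluing 3} {a b : ℕ} (hab : a ≠ b)
    (ha : 3 ≤ (G.ends a).card) (hb : 3 ≤ (G.ends b).card) :
    Nonempty (G.Space ≃ₜ handcuffs.Space) ∨ Nonempty (G.Space ≃ₜ theta.Space) := by
  have hdisj : Disjoint (G.ends a) (G.ends b) := by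
    refine Finset.disjoint_left.2 fun p hp hq => hab ?_
    simp only [ends, Finset.mem_filter, Finset.mem_univ, true_and] at hp hq
    exact hp.symm.trans hq
  have hcard := Finset.card_union_of_disjoint hdisj
  have hle := Finset.card_le_univ (G.ends a ∪ G.ends b)
  have h6 : Fintype.card (Fin 3 × Bool) = 6 := by simp
  -- Each of the two labels needs three of the six ends, so no end is left over.
  have huniv : G.ends a ∪ G.ends b = Finset.univ :=
    Finset.eq_univ_of_card _ (by omega)
  have hor (p) : G.lab p = a ∨ G.lab p = b := by
    have : p ∈ G.ends a ∪ G.ends b := by simp [huniv]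
    simpa [ends] using this
  have hlab (p q) : G.lab p = G.lab q ↔
      decide (G.lab p = a) = decide (G.lab q = a) := by
    rcases hor p with hp | hp <;> rcases hor q with hq | hq <;> simp [hp, hq, hab, hab.symm]
  have hc : (Finset.univ.filter fun p => decide (G.lab p = a) = true).card = 3 := by
    have : (Finset.univ.filter fun p => decide (G.lab p = a) = true) = G.ends a := by simp [ends]
    rw [this]
    omega
  rcases theta_or_handcuffs_of_coloring (fun p => decide (G.lab p = a)) hc with
    ⟨ε, h⟩ | ⟨e, ε, h⟩
  · exact .inr (nonempty_homeomorph_of_lab (Equiv.refl _) ε fun p q => (hlab p q).trans (h p q))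
  · exact .inl (nonempty_homeomorph_of_lab e ε fun p q => (hlab p q).trans (h p q))

end Gluing

theorem IsTangle.exists_isMinimal {T : Type*} [TopologicalSpace T] (hT : IsTangle T) :
    ∃ (m : ℕ) (G : Gluing m), G.IsMinimal ∧ Nonempty (T ≃ₜ G.Space) := by
  classical
  have hex := hT.2
  obtain ⟨G, ⟨h⟩⟩ := Nat.find_spec hex
  exact ⟨_, G, fun m' G' ⟨h'⟩ => Nat.find_min' hex ⟨G', ⟨h.trans h'⟩⟩, ⟨h⟩⟩

/-- A tangle with few edges compared to its glued points is basic stringable. -/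
theorem Gluing.IsMinimal.isBasicStringable {m : ℕ} {G : Gluing m} (hG : G.IsMinimal)
    [ConnectedSpace G.Space] (h : m ≤ G.innerLabels.card + 1) : IsBasicStringable G.Space := by
  rcases lt_or_ge m 2 with hm | hm
  · obtain rfl | rfl : m = 0 ∨ m = 1 := by omega
    · obtain ⟨x⟩ : Nonempty G.Space := inferInstance
      obtain ⟨i, -⟩ := G.exists_mk x
      exact i.elim0
    · by_cases h01 : (G 0).1 = (G 0).2
      · exact .inr (.inl (nonempty_homeomorph_circle h01))
      · exact .inl (nonempty_homeomorph_interval h01)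
  · have h3 : ∀ a ∈ G.innerLabels, 3 ≤ (G.ends a).card := fun a ha => hG.three_le_card_ends hm ha
    have hle := three_mul_card_innerLabels_le h3
    -- With `V` glued points, `m ≤ V + 1` and `3V ≤ 2m` give `m ≤ 3`.
    obtain rfl | rfl : m = 2 ∨ m = 3 := by omega
    · obtain ⟨a, ha⟩ := Finset.card_pos.1 (by omega : 0 < G.innerLabels.card)
      rcases nonempty_homeomorph_of_two_edges (h3 a ha) with h | h
      · exact .inr (.inr (.inl h))
      · exact .inr (.inr (.inr (.inl h)))
    · obtain ⟨a, ha, b, hb, hab⟩ := Finset.one_lt_card.1 (by omega : 1 < G.innerLabels.card)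
      exact .inr (.inr (.inr (.inr (nonempty_homeomorph_of_three_edges hab (h3 a ha) (h3 b hb)))))

theorem IsBasicStringable.of_homeomorph {S T : Type*} [TopologicalSpace S] [TopologicalSpace T]
    (e : T ≃ₜ S) (h : IsBasicStringable S) : IsBasicStringable T := by
  rcases h with ⟨⟨f⟩⟩ | ⟨⟨f⟩⟩ | ⟨⟨f⟩⟩ | ⟨⟨f⟩⟩ | ⟨⟨f⟩⟩ | ⟨⟨f⟩⟩
  · exact .inl ⟨e.trans f⟩
  · exact .inr (.inl ⟨e.trans f⟩)
  · exact .inr (.inr (.inl ⟨e.trans f⟩))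
  · exact .inr (.inr (.inr (.inl ⟨e.trans f⟩)))
  · exact .inr (.inr (.inr (.inr (.inl ⟨e.trans f⟩))))
  · exact .inr (.inr (.inr (.inr (.inr ⟨e.trans f⟩))))

theorem mainTheorem1 (T : Type*) [TopologicalSpace T] (hT : IsTangle T)
    (hT' : ¬ IsBasicStringable T) :
    ∃ n₀ : ℕ, ∀ n : ℕ, GuaranteesEnvyFree T n → n ≤ n₀ := by
  obtain ⟨m, G, hG, ⟨h⟩⟩ := hT.exists_isMinimal
  have := hT.1
  have : ConnectedSpace G.Space := h.surjective.connectedSpace h.continuous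
  refine ⟨G.innerLabels.card + 1, fun n hn => le_of_guaranteesEnvyFree h ?_ hn⟩
  by_contra! hm
  exact hT' (IsBasicStringable.of_homeomorph h (hG.isBasicStringable hm))
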